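/- For an integer $n\ge 1$ and a real number $r$ let $$P_n(r)=\left(\frac{\frac1n\sum_{i=1}^{n}i^r}{\frac1{n+1}\sum_{i=1}^{n+1}i^r}\right)^{1/r}\quad (r\ne 0),\qquad P_n(0)=\frac{\sqrt[n]{n!}}{\sqrt[n+1]{(n+1)!}}.$$ Then for every integer $n\ge 1$ the function $r\mapsto P_n(r)$ is decreasing (in the weak sense, i.e. non-increasing) on $(-\infty,1]$. Moreover, $P_n(r)\ge P_n(r')$ for all real numbers $r, r'$ with $r\le 1$ and $r'>r$ (here $r'$ may exceed $1$). In particular, taking $r=0$, for all $r'>0$, $$\frac{\sqrt[n]{n!}}{\sqrt[n+1]{(n+1)!}}\ \ge\ P_n(r'),$$ which is (the non-strict form of) Martins' inequality. -/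

import Mathlib

noncomputable section

/-- The ratio of consecutive power means of order `r` of a sequence `a 1, a 2, a 3, …` of positive
real numbers (the value `a 0` is not used): the power mean of the first `n` terms divided by the
power mean of the first `n + 1` terms. For `r = 0` the power mean is the geometric mean. -/
def powerMeanRatio (a : ℕ → ℝ) (n : ℕ) (r : ℝ) : ℝ :=
  if r = 0 then
    (∏ i ∈ Finset.Icc 1 n, a i) ^ (1 / (n : ℝ)) /
      (∏ i ∈ Finset.Icc 1 (n + 1), a i) ^ (1 / ((n : ℝ) + 1))
  else
    ((1 / (n : ℝ) * ∑ i ∈ Finset.Icc 1 n, a i ^ r) /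
      (1 / ((n : ℝ) + 1) * ∑ i ∈ Finset.Icc 1 (n + 1), a i ^ r)) ^ (1 / r)

/-- `P n r` is the ratio of consecutive power means of order `r` of the sequence `1, 2, 3, …` of
positive integers. -/
def P (n : ℕ) (r : ℝ) : ℝ :=
  powerMeanRatio (fun i : ℕ => (i : ℝ)) n r

end

/-! For r ≠ 0 put a_i = i^r and divide the first n terms by their mean. With φ(x) = x^(r'/r), the
claim compares the φ-means of the normalized n and n+1 terms; for convex φ the mean grows with n
(`ConvexOn.normalized_mean_le`). To see this, interpolate the n+1 terms linearly to n points with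
the same mean. Jensen shows that this does not raise the φ-mean, and the n points majorize the
normalized n terms, so Karamata applies. Majorization amounts to monotonicity in k of (a_1 + … +
a_k)/(k a_(k+1)), the mean of x^r over 1/(k+1), …, k/(k+1). It decreases when x^r is concave (0 ≤ r
≤ 1). When r ≤ 0 it increases, but a_i then decreases, so both signs flip together. If r' = 0, log
replaces φ; if r = 0, logarithms are centered instead of normalized, and φ is an exponential. -/

/-! ### Tangent lines and majorization -/

/-- A convex function on an open set lies above its tangent lines of slope its right derivative. -/
lemma ConvexOn.add_rightDeriv_mul_le {I : Set ℝ} {φ : ℝ → ℝ} (hI : IsOpen I)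
    (hφ : ConvexOn ℝ I φ) {x y : ℝ} (hx : x ∈ I) (hy : y ∈ I) :
    φ x + derivWithin φ (Set.Ioi x) x * (y - x) ≤ φ y := by
  have hxi : x ∈ interior I := by rwa [hI.interior_eq]
  rcases lt_trichotomy x y with h | rfl | h
  · have := hφ.rightDeriv_le_slope_of_mem_interior hxi hy h
    rw [slope_def_field, le_div_iff₀ (sub_pos.2 h)] at this
    linarith
  · simp
  · have := (hφ.slope_le_leftDeriv_of_mem_interior hy hxi h).trans
      (hφ.leftDeriv_le_rightDeriv_of_mem_interior hxi)
    rw [slope_def_field, div_le_iff₀ (sub_pos.2 h)] at this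
    linarith

/-- A form of Karamata's inequality: the condition on the partial sums only has the sign that
matches the direction in which `u` moves. -/
lemma ConvexOn.sum_le_sum_of_partial_sums {I : Set ℝ} {φ : ℝ → ℝ} (hI : IsOpen I)
    (hφ : ConvexOn ℝ I φ) {n : ℕ} {u w : ℕ → ℝ} (hu : ∀ i < n, u i ∈ I) (hw : ∀ i < n, w i ∈ I)
    (heq : ∑ i ∈ Finset.range n, u i = ∑ i ∈ Finset.range n, w i)
    (h : (∀ k, k + 1 < n → u k ≤ u (k + 1) ∧
          ∑ i ∈ Finset.range (k + 1), w i ≤ ∑ i ∈ Finset.range (k + 1), u i) ∨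
      (∀ k, k + 1 < n → u (k + 1) ≤ u k ∧
          ∑ i ∈ Finset.range (k + 1), u i ≤ ∑ i ∈ Finset.range (k + 1), w i)) :
    ∑ i ∈ Finset.range n, φ (u i) ≤ ∑ i ∈ Finset.range n, φ (w i) := by
  have hmono : MonotoneOn (fun x ↦ derivWithin φ (Set.Ioi x) x) I := by
    have := hφ.monotoneOn_rightDeriv
    rwa [hI.interior_eq] at this
  set s : ℕ → ℝ := fun i ↦ derivWithin φ (Set.Ioi (u i)) (u i) with hs
  -- Abel summation: the boundary term vanishes because the totals agree, and each remaining term is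
  -- an increment of the slopes times a partial sum of `w - u`.
  have key : 0 ≤ ∑ i ∈ Finset.range n, s i • (w i - u i) := by
    rw [Finset.sum_range_by_parts, Finset.sum_sub_distrib, heq, sub_self, smul_zero, zero_sub,
      neg_nonneg]
    refine Finset.sum_nonpos fun k hk ↦ ?_
    have hk : k + 1 < n := by have := Finset.mem_range.1 hk; omega
    rw [Finset.sum_sub_distrib, smul_eq_mul]
    rcases h with h | h
    · exact mul_nonpos_of_nonneg_of_nonpos
        (sub_nonneg.2 (hmono (hu k (by omega)) (hu _ hk) (h k hk).1)) (sub_nonpos.2 (h k hk).2)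
    · exact mul_nonpos_of_nonpos_of_nonneg
        (sub_nonpos.2 (hmono (hu _ hk) (hu k (by omega)) (h k hk).1)) (sub_nonneg.2 (h k hk).2)
  have : ∑ i ∈ Finset.range n, (φ (u i) + s i • (w i - u i)) ≤ ∑ i ∈ Finset.range n, φ (w i) :=
    Finset.sum_le_sum fun i hi ↦ by
      have hi := Finset.mem_range.1 hi
      exact hφ.add_rightDeriv_mul_le hI (hu i hi) (hw i hi)
  rw [Finset.sum_add_distrib] at this
  linarith

/-! ### Comparing n terms with n + 1 terms -/

/-- Redistributing a sum of `k + 1` terms over `k` slots. -/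
lemma sum_range_interpolate (g : ℕ → ℝ) (N : ℝ) (k : ℕ) :
    ∑ i ∈ Finset.range k, ((N - i) * g i + (i + 1) * g (i + 1)) =
      N * ∑ i ∈ Finset.range k, g i + k * g k := by
  induction k with
  | zero => simp
  | succ k ih => rw [Finset.sum_range_succ, ih, Finset.sum_range_succ]; push_cast; ring

lemma sum_range_interpolate_self (g : ℕ → ℝ) (n : ℕ) :
    ∑ i ∈ Finset.range n, (((n : ℝ) - i) * g i + (i + 1) * g (i + 1)) =
      n * ∑ i ∈ Finset.range (n + 1), g i := by
  rw [sum_range_interpolate, Finset.sum_range_succ]; ring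

/-- Comparison of the means of `φ` over `n` terms `u` and over `n + 1` terms `v`. -/
lemma ConvexOn.mean_le_mean_succ {I : Set ℝ} {φ : ℝ → ℝ} (hI : IsOpen I)
    (hφ : ConvexOn ℝ I φ) {n : ℕ} (hn : 1 ≤ n) {u v : ℕ → ℝ}
    (hu : ∀ i < n, u i ∈ I) (hv : ∀ i ≤ n, v i ∈ I)
    (heq : (n + 1) * ∑ i ∈ Finset.range n, u i = n * ∑ i ∈ Finset.range (n + 1), v i)
    (h : (∀ k, k < n → u k ≤ u (k + 1) ∧
          n * ∑ i ∈ Finset.range k, v i + k * v k ≤ (n + 1) * ∑ i ∈ Finset.range k, u i) ∨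
      (∀ k, k < n → u (k + 1) ≤ u k ∧
          (n + 1) * ∑ i ∈ Finset.range k, u i ≤ n * ∑ i ∈ Finset.range k, v i + k * v k)) :
    1 / (n : ℝ) * ∑ i ∈ Finset.range n, φ (u i) ≤
      1 / ((n : ℝ) + 1) * ∑ i ∈ Finset.range (n + 1), φ (v i) := by
  have hn0 : (0 : ℝ) < n := by exact_mod_cast hn
  have hn1 : (0 : ℝ) < (n : ℝ) + 1 := by positivity
  -- Each `v i` receives total weight ((n - i) + i)/(n + 1) = n/(n + 1), so `w` has the same mean as
  -- `v`.
  set w : ℕ → ℝ := fun i ↦ (((n : ℝ) - i) / (n + 1)) • v i + (((i : ℝ) + 1) / (n + 1)) • v (i + 1)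
    with hwdef
  have hc : ∀ i < n, 0 ≤ ((n : ℝ) - i) / (n + 1) ∧ 0 ≤ ((i : ℝ) + 1) / (n + 1) ∧
      ((n : ℝ) - i) / (n + 1) + ((i : ℝ) + 1) / (n + 1) = 1 := fun i hi ↦ by
    have : (i : ℝ) ≤ n := by exact_mod_cast hi.le
    exact ⟨div_nonneg (by linarith) hn1.le, by positivity, by field_simp; ring⟩
  have hw : ∀ i < n, w i ∈ I := fun i hi ↦
    hφ.1 (hv i hi.le) (hv (i + 1) hi) (hc i hi).1 (hc i hi).2.1 (hc i hi).2.2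
  have hwsum : ∀ k, (n + 1) * ∑ i ∈ Finset.range k, w i =
      n * ∑ i ∈ Finset.range k, v i + k * v k := fun k ↦ by
    rw [← sum_range_interpolate, Finset.mul_sum]
    refine Finset.sum_congr rfl fun i _ ↦ ?_
    simp only [hwdef, smul_eq_mul]
    field_simp
  have h1 : ∑ i ∈ Finset.range n, φ (u i) ≤ ∑ i ∈ Finset.range n, φ (w i) := by
    refine hφ.sum_le_sum_of_partial_sums hI hu hw ?_ ?_
    · refine mul_left_cancel₀ hn1.ne' ?_
      rw [heq, hwsum, Finset.sum_range_succ]; ring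
    · rcases h with h | h
      · refine Or.inl fun k hk ↦ ⟨(h k (by omega)).1, le_of_mul_le_mul_left ?_ hn1⟩
        rw [hwsum]; exact (h _ hk).2
      · refine Or.inr fun k hk ↦ ⟨(h k (by omega)).1, le_of_mul_le_mul_left ?_ hn1⟩
        rw [hwsum]; exact (h _ hk).2
  have h2 : (n + 1) * ∑ i ∈ Finset.range n, φ (w i) ≤ n * ∑ i ∈ Finset.range (n + 1), φ (v i) := by
    rw [← sum_range_interpolate_self (fun i ↦ φ (v i)), Finset.mul_sum]
    refine Finset.sum_le_sum fun i hi ↦ ?_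
    have hi := Finset.mem_range.1 hi
    have := hφ.2 (hv i hi.le) (hv (i + 1) hi) (hc i hi).1 (hc i hi).2.1 (hc i hi).2.2
    have := mul_le_mul_of_nonneg_left this hn1.le
    refine this.trans_eq ?_
    simp only [smul_eq_mul]
    field_simp
  rw [one_div_mul_eq_div, one_div_mul_eq_div, div_le_div_iff₀ hn0 hn1]
  nlinarith

/-! ### Means over equally spaced points -/

/-- For concave `f`, the means of `f` over the points `1/(n+1), …, n/(n+1)` decrease with `n`. -/
lemma ConcaveOn.mean_equally_spaced_succ_le {f : ℝ → ℝ} (hf : ConcaveOn ℝ (Set.Ioi 0) f) {n : ℕ}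
    (hn : 1 ≤ n) :
    1 / ((n + 1 : ℕ) : ℝ) * ∑ i ∈ Finset.range (n + 1), f ((i + 1) / ((n + 1 : ℕ) + 1)) ≤
      1 / (n : ℝ) * ∑ i ∈ Finset.range n, f ((i + 1) / (n + 1)) := by
  have hn0 : (0 : ℝ) < n := by exact_mod_cast hn
  have hn1 : (0 : ℝ) < (n : ℝ) + 1 := by positivity
  have h2 : n * ∑ i ∈ Finset.range (n + 1), f ((i + 1) / ((n + 1 : ℕ) + 1)) ≤
      (n + 1) * ∑ i ∈ Finset.range n, f ((i + 1) / (n + 1)) := by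
    rw [← sum_range_interpolate_self (fun i ↦ f ((i + 1) / ((n + 1 : ℕ) + 1))), Finset.mul_sum]
    refine Finset.sum_le_sum fun i hi ↦ ?_
    have hi : (i : ℝ) ≤ n := by exact_mod_cast (Finset.mem_range.1 hi).le
    have hx : ((i : ℝ) + 1) / ((n + 1 : ℕ) + 1) ∈ Set.Ioi (0 : ℝ) := by
      simp only [Set.mem_Ioi]; positivity
    have hy : (((i + 1 : ℕ) : ℝ) + 1) / ((n + 1 : ℕ) + 1) ∈ Set.Ioi (0 : ℝ) := by
      simp only [Set.mem_Ioi]; positivity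
    have ha : 0 ≤ ((n : ℝ) - i) / (n + 1) := div_nonneg (by linarith) hn1.le
    have hb : 0 ≤ ((i : ℝ) + 1) / (n + 1) := by positivity
    have := hf.2 hx hy ha hb (by field_simp; ring)
    -- Each point of the coarser grid is a convex combination of two neighbours in the finer grid,
    -- with the same weights as above.
    have e : (((n : ℝ) - i) / (n + 1)) • (((i : ℝ) + 1) / ((n + 1 : ℕ) + 1)) +
        (((i : ℝ) + 1) / (n + 1)) • ((((i + 1 : ℕ) : ℝ) + 1) / ((n + 1 : ℕ) + 1)) =
        ((i : ℝ) + 1) / (n + 1) := by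
      simp only [smul_eq_mul]; push_cast; field_simp; ring
    rw [e] at this
    refine le_trans (le_of_eq ?_) (mul_le_mul_of_nonneg_left this hn1.le)
    simp only [smul_eq_mul]
    field_simp
  rw [one_div_mul_eq_div, one_div_mul_eq_div, div_le_div_iff₀ (by positivity) hn0]
  push_cast at h2 ⊢
  linarith

lemma ConcaveOn.mean_equally_spaced_le {f : ℝ → ℝ} (hf : ConcaveOn ℝ (Set.Ioi 0) f) {k n : ℕ}
    (hk : 1 ≤ k) (hkn : k ≤ n) :
    1 / (n : ℝ) * ∑ i ∈ Finset.range n, f ((i + 1) / (n + 1)) ≤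
      1 / (k : ℝ) * ∑ i ∈ Finset.range k, f ((i + 1) / (k + 1)) := by
  induction n, hkn using Nat.le_induction with
  | base => rfl
  | succ n hn ih => exact (hf.mean_equally_spaced_succ_le (hk.trans hn)).trans ih

/-! ### Normalized and centered means -/

/-- Comparison of `φ`-means of positive terms, each normalized by their arithmetic mean. -/
lemma ConvexOn.normalized_mean_le {φ : ℝ → ℝ} (hφ : ConvexOn ℝ (Set.Ioi 0) φ) {a : ℕ → ℝ}
    (ha : ∀ i, 0 < a i) {n : ℕ} (hn : 1 ≤ n)
    (h : (∀ k, k < n → a k ≤ a (k + 1) ∧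
          k * a k * ∑ i ∈ Finset.range n, a i ≤ n * a n * ∑ i ∈ Finset.range k, a i) ∨
      (∀ k, k < n → a (k + 1) ≤ a k ∧
          n * a n * ∑ i ∈ Finset.range k, a i ≤ k * a k * ∑ i ∈ Finset.range n, a i)) :
    1 / (n : ℝ) * ∑ i ∈ Finset.range n, φ (a i / (1 / (n : ℝ) * ∑ i ∈ Finset.range n, a i)) ≤
      1 / ((n : ℝ) + 1) * ∑ i ∈ Finset.range (n + 1),
        φ (a i / (1 / ((n : ℝ) + 1) * ∑ i ∈ Finset.range (n + 1), a i)) := by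
  have hn0 : (0 : ℝ) < n := by exact_mod_cast hn
  have hA : 0 < ∑ i ∈ Finset.range n, a i :=
    Finset.sum_pos (fun i _ ↦ ha i) (by simp; omega)
  have hA' : 0 < ∑ i ∈ Finset.range (n + 1), a i :=
    Finset.sum_pos (fun i _ ↦ ha i) (by simp)
  have hm : 0 < 1 / (n : ℝ) * ∑ i ∈ Finset.range n, a i := by positivity
  have hm' : 0 < 1 / ((n : ℝ) + 1) * ∑ i ∈ Finset.range (n + 1), a i := by positivity
  -- The majorization gap at `k` is the gap in `h` times a positive factor, so only its sign
  -- matters.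
  have key : ∀ k : ℕ,
      (n + 1) * ∑ i ∈ Finset.range k, a i / (1 / (n : ℝ) * ∑ i ∈ Finset.range n, a i) -
      (n * ∑ i ∈ Finset.range k, a i / (1 / ((n : ℝ) + 1) * ∑ i ∈ Finset.range (n + 1), a i) +
        k * (a k / (1 / ((n : ℝ) + 1) * ∑ i ∈ Finset.range (n + 1), a i))) =
      (n * a n * ∑ i ∈ Finset.range k, a i - k * a k * ∑ i ∈ Finset.range n, a i) *
      ((n + 1) / ((∑ i ∈ Finset.range n, a i) * ∑ i ∈ Finset.range (n + 1), a i)) := fun k ↦ by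
    rw [← Finset.sum_div, ← Finset.sum_div]
    have e : a n = ∑ i ∈ Finset.range (n + 1), a i - ∑ i ∈ Finset.range n, a i := by
      rw [Finset.sum_range_succ]; ring
    rw [e]
    field_simp
    ring
  have hpos : 0 < ((n : ℝ) + 1) /
      ((∑ i ∈ Finset.range n, a i) * ∑ i ∈ Finset.range (n + 1), a i) := by positivity
  refine hφ.mean_le_mean_succ isOpen_Ioi hn (fun i _ ↦ div_pos (ha i) hm)
    (fun i _ ↦ div_pos (ha i) hm') ?_ ?_
  · rw [← Finset.sum_div, ← Finset.sum_div]
    field_simp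
  · rcases h with h | h
    · refine Or.inl fun k hk ↦ ⟨div_le_div_of_nonneg_right (h k hk).1 hm.le, ?_⟩
      rw [← sub_nonneg, key]
      exact mul_nonneg (sub_nonneg.2 (h k hk).2) hpos.le
    · refine Or.inr fun k hk ↦ ⟨div_le_div_of_nonneg_right (h k hk).1 hm.le, ?_⟩
      rw [← sub_nonpos, key]
      exact mul_nonpos_of_nonpos_of_nonneg (sub_nonpos.2 (h k hk).2) hpos.le

/-- Comparison of `φ`-means of the first `n` terms, each centered at their arithmetic mean. -/
lemma ConvexOn.centered_mean_le {φ : ℝ → ℝ} (hφ : ConvexOn ℝ Set.univ φ) {a : ℕ → ℝ}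
    {n : ℕ} (hn : 1 ≤ n)
    (h : ∀ k, k < n → a k ≤ a (k + 1) ∧
      k * (1 / (n : ℝ) * ∑ i ∈ Finset.range n, a i - a n) ≤ ∑ i ∈ Finset.range k, a i - k * a k) :
    1 / (n : ℝ) * ∑ i ∈ Finset.range n, φ (a i - 1 / (n : ℝ) * ∑ i ∈ Finset.range n, a i) ≤
      1 / ((n : ℝ) + 1) * ∑ i ∈ Finset.range (n + 1),
        φ (a i - 1 / ((n : ℝ) + 1) * ∑ i ∈ Finset.range (n + 1), a i) := by
  have hn0 : (0 : ℝ) < n := by exact_mod_cast hn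
  have hn1 : (0 : ℝ) < (n : ℝ) + 1 := by positivity
  refine hφ.mean_le_mean_succ isOpen_univ hn (fun i _ ↦ trivial) (fun i _ ↦ trivial) ?_
    (Or.inl fun k hk ↦ ⟨by linarith [(h k hk).1], ?_⟩)
  · simp only [Finset.sum_sub_distrib, Finset.sum_const, Finset.card_range, nsmul_eq_mul]
    push_cast
    field_simp
    ring
  · have := (h k hk).2
    simp only [Finset.sum_sub_distrib, Finset.sum_const, Finset.card_range, nsmul_eq_mul]
    rw [← sub_nonneg] at this ⊢
    refine this.trans_eq ?_
    rw [Finset.sum_range_succ _ n]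
    field_simp
    ring

/-- x^p = exp(p log x), where p log x is convex for p ≤ 0 and exp is convex and increasing. -/
lemma convexOn_rpow_of_nonpos {p : ℝ} (hp : p ≤ 0) :
    ConvexOn ℝ (Set.Ioi 0) fun x : ℝ ↦ x ^ p := by
  refine ⟨convex_Ioi 0, fun x hx y hy a b ha hb hab ↦ ?_⟩
  have hz : a • x + b • y ∈ Set.Ioi (0 : ℝ) := convex_Ioi 0 hx hy ha hb hab
  have hlog := strictConcaveOn_log_Ioi.concaveOn.2 hx hy ha hb hab
  have hexp := convexOn_exp.2 (Set.mem_univ (Real.log x * p)) (Set.mem_univ (Real.log y * p))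
    ha hb hab
  simp only [Real.rpow_def_of_pos hx, Real.rpow_def_of_pos hy, Real.rpow_def_of_pos hz]
  refine le_trans (Real.exp_le_exp.2 ?_) hexp
  simp only [smul_eq_mul] at hlog ⊢
  nlinarith

/-! ### Power means of 1, …, n -/

/-- The arithmetic mean of `1 ^ r, …, n ^ r`. -/
noncomputable def meanRpow (n : ℕ) (r : ℝ) : ℝ := 1 / (n : ℝ) * ∑ i ∈ Finset.range n, ((i : ℝ) + 1) ^ r

/-- The arithmetic mean of `log 1, …, log n`. -/
noncomputable def meanLog (n : ℕ) : ℝ := 1 / (n : ℝ) * ∑ i ∈ Finset.range n, Real.log ((i : ℝ) + 1)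

lemma meanRpow_pos {n : ℕ} (hn : 1 ≤ n) (r : ℝ) : 0 < meanRpow n r := by
  have hn0 : (0 : ℝ) < n := by exact_mod_cast hn
  exact mul_pos (by positivity)
    (Finset.sum_pos (fun i _ ↦ by positivity) (by simp; omega))

lemma P_of_ne_zero {n : ℕ} (hn : 1 ≤ n) {r : ℝ} (hr : r ≠ 0) :
    P n r = Real.exp ((Real.log (meanRpow n r) - Real.log (meanRpow (n + 1) r)) / r) := by
  have h1 := meanRpow_pos hn r
  have h2 := meanRpow_pos (Nat.le_add_left 1 n) r
  have e : P n r = (meanRpow n r / meanRpow (n + 1) r) ^ (1 / r) := by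
    have hsum : ∀ m : ℕ, ∑ i ∈ Finset.range m, ((i : ℝ) + 1) ^ r =
        ∑ i ∈ Finset.Icc 1 m, (i : ℝ) ^ r := fun m ↦ by
      have := Finset.sum_Ico_add' (fun i : ℕ ↦ (i : ℝ) ^ r) 0 m 1
      rw [zero_add, Finset.Ico_add_one_right_eq_Icc, ← Finset.range_eq_Ico] at this
      exact_mod_cast this
    simp only [P, powerMeanRatio, if_neg hr, meanRpow, hsum, Nat.cast_add, Nat.cast_one]
  rw [e, Real.rpow_def_of_pos (div_pos h1 h2), Real.log_div h1.ne' h2.ne', mul_one_div]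

lemma sum_log_eq_log_factorial (n : ℕ) :
    ∑ i ∈ Finset.range n, Real.log ((i : ℝ) + 1) = Real.log n.factorial := by
  rw [← Finset.prod_range_add_one_eq_factorial, Nat.cast_prod, Real.log_prod]
  · push_cast; rfl
  · intro i _; positivity

lemma P_zero (n : ℕ) : P n 0 = (n.factorial : ℝ) ^ (1 / (n : ℝ)) /
    ((n + 1).factorial : ℝ) ^ (1 / ((n : ℝ) + 1)) := by
  have hprod : ∀ m : ℕ, ∏ i ∈ Finset.Icc 1 m, (i : ℝ) = m.factorial := fun m ↦ by
    rw [← Finset.Ico_add_one_right_eq_Icc, ← Nat.cast_prod, Finset.prod_Ico_id_eq_factorial]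
  simp only [P, powerMeanRatio, if_true, hprod]

lemma P_zero_eq_exp (n : ℕ) : P n 0 = Real.exp (meanLog n - meanLog (n + 1)) := by
  rw [P_zero, Real.rpow_def_of_pos (by positivity), Real.rpow_def_of_pos (by positivity),
    ← Real.exp_sub, meanLog, meanLog, sum_log_eq_log_factorial, sum_log_eq_log_factorial]
  push_cast
  congr 1
  ring

lemma mean_equally_spaced_rpow (n : ℕ) (r : ℝ) :
    1 / (n : ℝ) * ∑ i ∈ Finset.range n, (((i : ℝ) + 1) / (n + 1)) ^ r =
      meanRpow n r / ((n : ℝ) + 1) ^ r := by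
  rw [meanRpow, mul_div_assoc, Finset.sum_div]
  congr 1
  exact Finset.sum_congr rfl fun i _ ↦ Real.div_rpow (by positivity) (by positivity) _

lemma sum_eq_mul_meanRpow {n : ℕ} (hn : 1 ≤ n) (r : ℝ) :
    ∑ i ∈ Finset.range n, ((i : ℝ) + 1) ^ r = n * meanRpow n r := by
  have hn0 : (n : ℝ) ≠ 0 := by positivity
  rw [meanRpow]; field_simp

/-- The hypothesis of `ConvexOn.normalized_mean_le` for the sequence `1 ^ r, 2 ^ r, …`, `r ≤ 1`. -/
lemma rpow_partial_sums {r : ℝ} (hr : r ≤ 1) (n : ℕ) :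
    (∀ k : ℕ, k < n → ((k : ℝ) + 1) ^ r ≤ (((k + 1 : ℕ) : ℝ) + 1) ^ r ∧
      k * ((k : ℝ) + 1) ^ r * ∑ i ∈ Finset.range n, ((i : ℝ) + 1) ^ r ≤
        n * ((n : ℝ) + 1) ^ r * ∑ i ∈ Finset.range k, ((i : ℝ) + 1) ^ r) ∨
    (∀ k : ℕ, k < n → (((k + 1 : ℕ) : ℝ) + 1) ^ r ≤ ((k : ℝ) + 1) ^ r ∧
      n * ((n : ℝ) + 1) ^ r * ∑ i ∈ Finset.range k, ((i : ℝ) + 1) ^ r ≤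
        k * ((k : ℝ) + 1) ^ r * ∑ i ∈ Finset.range n, ((i : ℝ) + 1) ^ r) := by
  rcases le_total 0 r with h0 | h0
  · refine Or.inl fun k hk ↦ ⟨Real.rpow_le_rpow (by positivity) (by push_cast; linarith) h0, ?_⟩
    rcases Nat.eq_zero_or_pos k with rfl | hk0
    · simp
    have := ((Real.concaveOn_rpow h0 hr).subset Set.Ioi_subset_Ici_self
      (convex_Ioi 0)).mean_equally_spaced_le hk0 hk.le
    rw [mean_equally_spaced_rpow, mean_equally_spaced_rpow,
      div_le_div_iff₀ (by positivity) (by positivity)] at this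
    rw [sum_eq_mul_meanRpow hk0, sum_eq_mul_meanRpow (hk0.trans_le hk.le)]
    have := mul_le_mul_of_nonneg_left this (by positivity : (0 : ℝ) ≤ k * n)
    linarith
  · refine Or.inr fun k hk ↦
      ⟨Real.rpow_le_rpow_of_nonpos (by positivity) (by push_cast; linarith) h0, ?_⟩
    rcases Nat.eq_zero_or_pos k with rfl | hk0
    · simp
    have := (convexOn_rpow_of_nonpos h0).neg.mean_equally_spaced_le hk0 hk.le
    simp only [Pi.neg_apply, Finset.sum_neg_distrib, mul_neg, neg_le_neg_iff] at this
    rw [mean_equally_spaced_rpow, mean_equally_spaced_rpow,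
      div_le_div_iff₀ (by positivity) (by positivity)] at this
    rw [sum_eq_mul_meanRpow hk0, sum_eq_mul_meanRpow (hk0.trans_le hk.le)]
    have := mul_le_mul_of_nonneg_left this (by positivity : (0 : ℝ) ≤ k * n)
    linarith

lemma normalized_mean_rpow_le {φ : ℝ → ℝ} (hφ : ConvexOn ℝ (Set.Ioi 0) φ) {r : ℝ} (hr : r ≤ 1)
    {n : ℕ} (hn : 1 ≤ n) :
    1 / (n : ℝ) * ∑ i ∈ Finset.range n, φ (((i : ℝ) + 1) ^ r / meanRpow n r) ≤
      1 / ((n + 1 : ℕ) : ℝ) * ∑ i ∈ Finset.range (n + 1),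
        φ (((i : ℝ) + 1) ^ r / meanRpow (n + 1) r) := by
  have := hφ.normalized_mean_le (a := fun i : ℕ ↦ ((i : ℝ) + 1) ^ r) (fun i ↦ by positivity) hn
    (rpow_partial_sums hr n)
  simpa only [meanRpow, Nat.cast_add, Nat.cast_one] using this

/-- The exponent r'/r turns i^r into i^r', so comparing these means for n and n + 1 compares the
logarithms of P_n(r) and P_n(r'). -/
lemma mean_normalized_rpow {n : ℕ} (hn : 1 ≤ n) {r r' : ℝ} (hr : r ≠ 0) :
    1 / (n : ℝ) * ∑ i ∈ Finset.range n, (((i : ℝ) + 1) ^ r / meanRpow n r) ^ (r' / r) =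
      Real.exp (Real.log (meanRpow n r') - r' / r * Real.log (meanRpow n r)) := by
  have h := meanRpow_pos hn r
  rw [Real.exp_sub, Real.exp_log (meanRpow_pos hn r'), mul_comm (r' / r),
    ← Real.rpow_def_of_pos h]
  conv_rhs => rw [meanRpow, mul_div_assoc, Finset.sum_div]
  congr 1
  refine Finset.sum_congr rfl fun i _ ↦ ?_
  rw [Real.div_rpow (by positivity) h.le, ← Real.rpow_mul (by positivity), mul_div_cancel₀ _ hr]

lemma P_le_P_of_ne_zero {n : ℕ} (hn : 1 ≤ n) {r r' : ℝ} (hr : r ≤ 1) (hrr : r < r')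
    (h0 : r ≠ 0) (h0' : r' ≠ 0) : P n r' ≤ P n r := by
  rw [P_of_ne_zero hn h0, P_of_ne_zero hn h0', Real.exp_le_exp]
  have hn1 : 1 ≤ n + 1 := Nat.le_add_left 1 n
  -- Here r < r' < 0 puts r'/r in [0, 1], so the power is concave; the reversed inequality is
  -- reversed back on dividing by r' < 0.
  by_cases hneg : r' < 0
  · have hp0 : 0 ≤ r' / r := div_nonneg_of_nonpos hneg.le (hrr.trans hneg).le
    have hp1 : r' / r ≤ 1 := (div_le_one_of_neg (hrr.trans hneg)).2 hrr.le
    have := normalized_mean_rpow_le ((Real.concaveOn_rpow hp0 hp1).subset Set.Ioi_subset_Ici_self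
      (convex_Ioi 0)).neg hr hn
    simp only [Pi.neg_apply, Finset.sum_neg_distrib, mul_neg, neg_le_neg_iff] at this
    rw [mean_normalized_rpow hn h0, mean_normalized_rpow hn1 h0, Real.exp_le_exp] at this
    rw [div_le_iff_of_neg hneg]
    have e : r' / r * (Real.log (meanRpow n r) - Real.log (meanRpow (n + 1) r)) =
      (Real.log (meanRpow n r) - Real.log (meanRpow (n + 1) r)) / r * r' := by ring
    linarith
  · have hpos : 0 < r' := lt_of_le_of_ne (not_lt.1 hneg) h0'.symm
    -- The exponent is nonpositive if r < 0 and at least 1 if 0 < r < r'; both give convexity.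
    have hφ : ConvexOn ℝ (Set.Ioi 0) fun x : ℝ ↦ x ^ (r' / r) := by
      rcases lt_or_gt_of_ne h0 with h | h
      · exact convexOn_rpow_of_nonpos (div_nonpos_of_nonneg_of_nonpos hpos.le h.le)
      · exact (convexOn_rpow ((one_le_div h).2 hrr.le)).subset Set.Ioi_subset_Ici_self
          (convex_Ioi 0)
    have := normalized_mean_rpow_le hφ hr hn
    rw [mean_normalized_rpow hn h0, mean_normalized_rpow hn1 h0, Real.exp_le_exp] at this
    rw [div_le_iff₀ hpos]
    have e : r' / r * (Real.log (meanRpow n r) - Real.log (meanRpow (n + 1) r)) =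
      (Real.log (meanRpow n r) - Real.log (meanRpow (n + 1) r)) / r * r' := by ring
    linarith

lemma mean_log_normalized_rpow {n : ℕ} (hn : 1 ≤ n) (r : ℝ) :
    1 / (n : ℝ) * ∑ i ∈ Finset.range n, Real.log (((i : ℝ) + 1) ^ r / meanRpow n r) =
      r * meanLog n - Real.log (meanRpow n r) := by
  have hn0 : (n : ℝ) ≠ 0 := by positivity
  have : ∀ i ∈ Finset.range n, Real.log (((i : ℝ) + 1) ^ r / meanRpow n r) =
      r * Real.log ((i : ℝ) + 1) - Real.log (meanRpow n r) := fun i _ ↦ by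
    rw [Real.log_div (by positivity) (meanRpow_pos hn r).ne', Real.log_rpow (by positivity)]
  rw [Finset.sum_congr rfl this, Finset.sum_sub_distrib, ← Finset.mul_sum, meanLog]
  simp only [Finset.sum_const, Finset.card_range, nsmul_eq_mul]
  field_simp

lemma P_zero_le {n : ℕ} (hn : 1 ≤ n) {r : ℝ} (hr : r < 0) : P n 0 ≤ P n r := by
  rw [P_of_ne_zero hn hr.ne, P_zero_eq_exp, Real.exp_le_exp, le_div_iff_of_neg hr]
  have := normalized_mean_rpow_le strictConcaveOn_log_Ioi.concaveOn.neg (hr.le.trans zero_le_one) hn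
  simp only [Pi.neg_apply, Finset.sum_neg_distrib, mul_neg, neg_le_neg_iff] at this
  rw [mean_log_normalized_rpow hn, mean_log_normalized_rpow (Nat.le_add_left 1 n)] at this
  linarith

lemma mean_exp_centered_log {n : ℕ} (hn : 1 ≤ n) (r : ℝ) :
    1 / (n : ℝ) * ∑ i ∈ Finset.range n, Real.exp (r * (Real.log ((i : ℝ) + 1) - meanLog n)) =
      Real.exp (Real.log (meanRpow n r) - r * meanLog n) := by
  rw [Real.exp_sub, Real.exp_log (meanRpow_pos hn r), meanRpow, mul_div_assoc, Finset.sum_div]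
  congr 1
  refine Finset.sum_congr rfl fun i _ ↦ ?_
  rw [Real.rpow_def_of_pos (by positivity), ← Real.exp_sub]
  ring_nf

/-- Concavity of log on equally spaced points, since the mean of log(i/(m + 1)) over i ≤ m is the
mean of log i minus log(m + 1). -/
lemma log_partial_sums (n k : ℕ) (hk : k < n) :
    Real.log ((k : ℝ) + 1) ≤ Real.log (((k + 1 : ℕ) : ℝ) + 1) ∧
    k * (1 / (n : ℝ) * ∑ i ∈ Finset.range n, Real.log ((i : ℝ) + 1) - Real.log ((n : ℝ) + 1)) ≤
      ∑ i ∈ Finset.range k, Real.log ((i : ℝ) + 1) - k * Real.log ((k : ℝ) + 1) := by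
  refine ⟨Real.log_le_log (by positivity) (by push_cast; linarith), ?_⟩
  rcases Nat.eq_zero_or_pos k with rfl | hk0
  · simp
  have hs : ∀ m : ℕ, 1 ≤ m → 1 / (m : ℝ) * ∑ i ∈ Finset.range m, Real.log (((i : ℝ) + 1) / (m + 1))
      = 1 / (m : ℝ) * ∑ i ∈ Finset.range m, Real.log ((i : ℝ) + 1) - Real.log ((m : ℝ) + 1) := by
    intro m hm
    have hm0 : (m : ℝ) ≠ 0 := by positivity
    have : ∀ i ∈ Finset.range m, Real.log (((i : ℝ) + 1) / (m + 1)) =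
        Real.log ((i : ℝ) + 1) - Real.log ((m : ℝ) + 1) := fun i _ ↦
      Real.log_div (by positivity) (by positivity)
    rw [Finset.sum_congr rfl this, Finset.sum_sub_distrib]
    simp only [Finset.sum_const, Finset.card_range, nsmul_eq_mul]
    field_simp
  have := strictConcaveOn_log_Ioi.concaveOn.mean_equally_spaced_le hk0 hk.le
  rw [hs n (hk0.trans_le hk.le), hs k hk0] at this
  have hk' : (0 : ℝ) < k := by exact_mod_cast hk0
  refine (mul_le_mul_of_nonneg_left this hk'.le).trans_eq ?_
  field_simp

/-- Since i^0 is constant, normalizing carries no information at order 0; centered logarithms and x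
↦ exp(r x) take over. -/
lemma P_le_zero {n : ℕ} (hn : 1 ≤ n) {r : ℝ} (hr : 0 < r) : P n r ≤ P n 0 := by
  rw [P_of_ne_zero hn hr.ne', P_zero_eq_exp, Real.exp_le_exp, div_le_iff₀ hr]
  have hφ : ConvexOn ℝ Set.univ fun x : ℝ ↦ Real.exp (r * x) := by
    exact convexOn_exp.comp_linearMap (LinearMap.mul ℝ ℝ r)
  have := hφ.centered_mean_le (a := fun i : ℕ ↦ Real.log ((i : ℝ) + 1)) hn (log_partial_sums n)
  have : Real.exp (Real.log (meanRpow n r) - r * meanLog n) ≤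
      Real.exp (Real.log (meanRpow (n + 1) r) - r * meanLog (n + 1)) := by
    rw [← mean_exp_centered_log hn, ← mean_exp_centered_log (Nat.le_add_left 1 n)]
    simpa only [meanLog, Nat.cast_add, Nat.cast_one] using this
  rw [Real.exp_le_exp] at this
  linarith

lemma P_le_P {n : ℕ} (hn : 1 ≤ n) {r r' : ℝ} (hr : r ≤ 1) (hrr : r < r') : P n r' ≤ P n r := by
  rcases eq_or_ne r 0 with rfl | h0
  · exact P_le_zero hn hrr
  rcases eq_or_ne r' 0 with rfl | h0'
  · exact P_zero_le hn hrr
  exact P_le_P_of_ne_zero hn hr hrr h0 h0'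

theorem corollary3 (n : ℕ) (hn : 1 ≤ n) :
    AntitoneOn (fun r : ℝ => P n r) (Set.Iic 1) ∧
    (∀ r r' : ℝ, r ≤ 1 → r < r' → P n r' ≤ P n r) ∧
    (∀ r' : ℝ, 0 < r' →
      P n r' ≤ (n.factorial : ℝ) ^ (1 / (n : ℝ)) /
        ((n + 1).factorial : ℝ) ^ (1 / ((n : ℝ) + 1))) := by
  refine ⟨fun r hr r' _ h ↦ ?_, fun r r' ↦ P_le_P hn, fun r' h ↦ ?_⟩
  · rcases h.eq_or_lt with rfl | h
    · exact le_rfl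
    · exact P_le_P hn hr h
  · rw [← P_zero]
    exact P_le_zero hn h
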